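/- Let $m\in\mathbb N$, let $E_1,\dots,E_m,F$ be (real) Banach lattices, let $A\colon E_1\times\cdots\times E_m\to F$ be a Riesz multimorphism, that is, an $m$-linear operator which is regular (a difference of two positive $m$-linear operators) and satisfies $|A(x_1,\dots,x_m)|=A(|x_1|,\dots,|x_m|)$ for all $x_i\in E_i$, and let $\rho$ be a permutation of $\{1,\dots,m\}$. Topological duals carry the dual order ($f\le g$ if and only if $f(a)\le g(a)$ for all $a\ge 0$), for which they are Banach lattices. For $x^{**}\in E_{\rho(k)}^{**}$ let $\overline{x^{**}}^{\rho}$ be the operator that sends a regular multilinear form $B$ in the variables $x_i$, $i\notin\{\rho(1),\dots,\rho(k-1)\}$, to the regular multilinear form in the variables $x_i$, $i\notin\{\rho(1),\dots,\rho(k)\}$, obtained by applying $x^{**}$ to $B$ as a functional of the variable $x_{\rho(k)}\in E_{\rho(k)}$, the other variables being fixed (for $k=m$ it is the number $x^{**}(B)$). The Aron-Berner extension $AB_m^\rho(A)\colon E_1^{**}\times\cdots\times E_m^{**}\to F^{**}$ is the $m$-linear operator $$AB_m^\rho(A)(x_1^{**},\dots,x_m^{**})(y^*)=\Big(\overline{x_{\rho(m)}^{**}}^{\rho}\circ\cdots\circ\overline{x_{\rho(1)}^{**}}^{\rho}\Big)(y^*\circ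 A),\qquad y^*\in F^*.$$ Then: (a) $y^{***}\circ AB_m^\rho(A)\colon E_1^{**}\times\cdots\times E_m^{**}\to\mathbb R$ is a Riesz multimorphism for every $w^*$-continuous Riesz homomorphism $y^{***}\in F^{***}$. (b) For all $x_1^{**}\in E_1^{**},\dots,x_m^{**}\in E_m^{**}$ and every $y^*$ in the norm-closed linear span of $\{\varphi\in F^*:\varphi\text{ is a Riesz homomorphism}\}$, $$|AB_m^\rho(A)(x_1^{**},\dots,x_m^{**})|(y^*)=AB_m^\rho(A)(|x_1^{**}|,\dots,|x_m^{**}|)(y^*).$$ -/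

import Mathlib

universe u v w

noncomputable section

open Set

/-! ### The dual Banach lattice

For a Banach lattice `E`, the topological dual `E*` carries the order `f ≤ g ↔ f a ≤ g a` for all
`a ≥ 0`, for which it is again a Banach lattice (Riesz-Kantorovich). -/

section DualLattice

variable {E : Type u} [NormedAddCommGroup E] [NormedSpace ℝ E] [Lattice E]
  [IsOrderedAddMonoid E] [HasSolidNorm E]

theorem le_opNorm_of_abs_le (f : StrongDual ℝ E) {a b : E} (h : |b| ≤ |a|) :
    f b ≤ ‖f‖ * ‖a‖ :=
  (le_abs_self _).trans ((f.le_opNorm b).trans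
    (mul_le_mul_of_nonneg_left (HasSolidNorm.solid h) (norm_nonneg f)))

/-- The Riesz-Kantorovich formula for the positive part, on the positive cone:
`f⁺ a = sup {f b : 0 ≤ b ≤ a}`. -/
def dualPosCone (f : StrongDual ℝ E) (a : E) : ℝ := sSup ((fun b => f b) '' Icc 0 a)

theorem dualPosCone_isLUB (f : StrongDual ℝ E) {a : E} (ha : 0 ≤ a) :
    IsLUB ((fun b => f b) '' Icc 0 a) (dualPosCone f a) := by
  refine isLUB_csSup ⟨_, mem_image_of_mem _ (⟨le_rfl, ha⟩ : (0 : E) ∈ Icc 0 a)⟩ ⟨‖f‖ * ‖a‖, ?_⟩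
  rintro _ ⟨b, hb, rfl⟩
  exact le_opNorm_of_abs_le f (by rw [abs_of_nonneg hb.1, abs_of_nonneg ha]; exact hb.2)

theorem le_dualPosCone (f : StrongDual ℝ E) {a b : E} (hb : 0 ≤ b) (hba : b ≤ a) :
    f b ≤ dualPosCone f a :=
  (dualPosCone_isLUB f (hb.trans hba)).1 ⟨b, ⟨hb, hba⟩, rfl⟩

theorem dualPosCone_le (f : StrongDual ℝ E) {a : E} (ha : 0 ≤ a) {c : ℝ}
    (h : ∀ b, 0 ≤ b → b ≤ a → f b ≤ c) : dualPosCone f a ≤ c := by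
  refine (dualPosCone_isLUB f ha).2 ?_
  rintro _ ⟨b, hb, rfl⟩
  exact h b hb.1 hb.2

theorem dualPosCone_nonneg (f : StrongDual ℝ E) {a : E} (ha : 0 ≤ a) : 0 ≤ dualPosCone f a := by
  simpa using le_dualPosCone f le_rfl ha

theorem dualPosCone_add (f : StrongDual ℝ E) {a b : E} (ha : 0 ≤ a) (hb : 0 ≤ b) :
    dualPosCone f (a + b) = dualPosCone f a + dualPosCone f b := by
  apply le_antisymm
  · refine dualPosCone_le f (add_nonneg ha hb) fun c hc hcab => ?_
    have h1 : f (c ⊓ a) ≤ dualPosCone f a := le_dualPosCone f (le_inf hc ha) inf_le_right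
    have h2 : f (c - c ⊓ a) ≤ dualPosCone f b := by
      refine le_dualPosCone f (sub_nonneg.2 inf_le_left) ?_
      rw [sub_le_comm]
      exact le_inf (sub_le_self _ hb) (sub_le_iff_le_add.2 hcab)
    have h3 := map_sub f c (c ⊓ a)
    linarith
  · have key : ∀ d, 0 ≤ d → d ≤ b → f d ≤ dualPosCone f (a + b) - dualPosCone f a := by
      intro d hd hdb
      have : dualPosCone f a ≤ dualPosCone f (a + b) - f d := by
        refine dualPosCone_le f ha fun c hc hca => ?_
        have := le_dualPosCone f (add_nonneg hc hd) (add_le_add hca hdb)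
        rw [map_add] at this
        linarith
      linarith
    have := dualPosCone_le f hb key
    linarith

theorem dualPosCone_bound (f : StrongDual ℝ E) {a x : E} (ha : 0 ≤ a) (hax : a ≤ |x|) :
    dualPosCone f a ≤ ‖f‖ * ‖x‖ := by
  refine dualPosCone_le f ha fun b hb hba => le_opNorm_of_abs_le f ?_
  rw [abs_of_nonneg hb]
  exact hba.trans hax

/-- The positive part `f⁺` of a continuous functional `f`. -/
def dualPos (f : StrongDual ℝ E) : StrongDual ℝ E :=
  AddMonoidHom.toRealLinearMap
    (AddMonoidHom.mk' (fun x : E => dualPosCone f (x⁺) - dualPosCone f (x⁻)) (by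
      intro x y
      have e : (x + y)⁺ + (x⁻ + y⁻) = (x + y)⁻ + (x⁺ + y⁺) := by
        have h1 := posPart_sub_negPart (x + y)
        have h2 := posPart_sub_negPart x
        have h3 := posPart_sub_negPart y
        rw [← sub_eq_zero]
        calc (x + y)⁺ + (x⁻ + y⁻) - ((x + y)⁻ + (x⁺ + y⁺))
            = ((x + y)⁺ - (x + y)⁻) - (x⁺ - x⁻) - (y⁺ - y⁻) := by abel
          _ = 0 := by rw [h1, h2, h3]; abel
      have e' := congrArg (dualPosCone f) e
      have hp := fun z : E => posPart_nonneg z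
      have hn := fun z : E => negPart_nonneg z
      rw [dualPosCone_add f (hp _) (add_nonneg (hn _) (hn _)), dualPosCone_add f (hn _) (hn _),
        dualPosCone_add f (hn _) (add_nonneg (hp _) (hp _)),
        dualPosCone_add f (hp _) (hp _)] at e'
      linarith))
    (AddMonoidHomClass.continuous_of_bound _ ‖f‖ (by
      intro x
      have h1 := dualPosCone_bound f (posPart_nonneg x) (sup_le (le_abs_self x) (abs_nonneg x))
      have h2 := dualPosCone_bound f (negPart_nonneg x) (sup_le (neg_le_abs x) (abs_nonneg x))
      have h3 := dualPosCone_nonneg f (posPart_nonneg x)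
      have h4 := dualPosCone_nonneg f (negPart_nonneg x)
      simp only [AddMonoidHom.mk'_apply, Real.norm_eq_abs]
      rw [abs_le]
      constructor <;> linarith))

theorem dualPos_apply (f : StrongDual ℝ E) {a : E} (ha : 0 ≤ a) :
    dualPos f a = dualPosCone f a := by
  have h0 : dualPosCone f 0 = 0 := by
    have := dualPosCone_add f (le_refl (0 : E)) le_rfl
    rw [add_zero] at this
    linarith
  change dualPosCone f (a⁺) - dualPosCone f (a⁻) = _
  rw [posPart_of_nonneg ha, negPart_of_nonneg ha, h0, sub_zero]

instance dualPartialOrder : PartialOrder (StrongDual ℝ E) where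
  le f g := ∀ a : E, 0 ≤ a → f a ≤ g a
  le_refl _ _ _ := le_rfl
  le_trans _ _ _ h h' a ha := (h a ha).trans (h' a ha)
  le_antisymm f g h h' := by
    ext x
    have hp := le_antisymm (h _ (posPart_nonneg x)) (h' _ (posPart_nonneg x))
    have hn := le_antisymm (h _ (negPart_nonneg x)) (h' _ (negPart_nonneg x))
    rw [← posPart_sub_negPart x, map_sub, map_sub, hp, hn]

theorem dual_le_def {f g : StrongDual ℝ E} : f ≤ g ↔ ∀ a : E, 0 ≤ a → f a ≤ g a := Iff.rfl

instance dualLattice : Lattice (StrongDual ℝ E) where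
  __ := dualPartialOrder
  sup f g := g + dualPos (f - g)
  inf f g := f - dualPos (f - g)
  le_sup_left f g a ha := by
    have := le_dualPosCone (f - g) ha le_rfl
    simp only [add_apply, sub_apply,
      dualPos_apply _ ha] at this ⊢
    linarith
  le_sup_right f g a ha := by
    have := dualPosCone_nonneg (f - g) ha
    simp only [add_apply, dualPos_apply _ ha]
    linarith
  sup_le f g h hf hg a ha := by
    have := dualPosCone_le (f - g) ha (c := h a - g a) fun b hb hba => by
      have h1 := hf b hb
      have h2 := hg (a - b) (sub_nonneg.2 hba)
      simp only [sub_apply, map_sub] at h2 ⊢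
      linarith
    simp only [add_apply, dualPos_apply _ ha]
    linarith
  inf_le_left f g a ha := by
    have := dualPosCone_nonneg (f - g) ha
    simp only [sub_apply, dualPos_apply _ ha]
    linarith
  inf_le_right f g a ha := by
    have := le_dualPosCone (f - g) ha le_rfl
    simp only [sub_apply, dualPos_apply _ ha] at this ⊢
    linarith
  le_inf h f g hf hg a ha := by
    have := dualPosCone_le (f - g) ha (c := f a - h a) fun b hb hba => by
      have h1 := hg b hb
      have h2 := hf (a - b) (sub_nonneg.2 hba)
      simp only [sub_apply, map_sub] at h2 ⊢
      linarith
    simp only [sub_apply, dualPos_apply _ ha]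
    linarith

instance dualIsOrderedAddMonoid : IsOrderedAddMonoid (StrongDual ℝ E) where
  add_le_add_left f g h k a ha := by
    have := h a ha
    simp only [add_apply]
    linarith

instance dualIsOrderedModule : IsOrderedModule ℝ (StrongDual ℝ E) where
  smul_le_smul_of_nonneg_left c hc f g h a ha := mul_le_mul_of_nonneg_left (h a ha) hc
  smul_le_smul_of_nonneg_right f hf c d h a ha :=
    mul_le_mul_of_nonneg_right h (by simpa using hf a ha)

instance dualHasSolidNorm : HasSolidNorm (StrongDual ℝ E) where
  solid f g h := by
    have bound : ∀ a : E, 0 ≤ a → |g| a ≤ ‖g‖ * ‖a‖ := by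
      intro a ha
      change (-g + dualPos (g - -g)) a ≤ _
      simp only [add_apply, neg_apply, dualPos_apply _ ha]
      have := dualPosCone_le (g - -g) ha (c := ‖g‖ * ‖a‖ + g a) fun b hb hba => by
        have h1 : g (b - (a - b)) ≤ ‖g‖ * ‖a‖ := by
          refine le_opNorm_of_abs_le g ?_
          rw [abs_of_nonneg ha]
          refine sup_le ?_ ?_
          · exact (sub_le_self _ (sub_nonneg.2 hba)).trans hba
          · rw [neg_sub]
            exact (sub_le_self _ hb).trans (sub_le_self _ hb)
        simp only [sub_apply, neg_apply, map_sub] at h1 ⊢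
        linarith
      linarith
    refine ContinuousLinearMap.opNorm_le_bound _ (norm_nonneg g) fun x => ?_
    have h1 : |f x| ≤ |f| |x| := by
      have hp := le_abs_self f (x⁺) (posPart_nonneg x)
      have hn := le_abs_self f (x⁻) (negPart_nonneg x)
      have hp' := neg_le_abs f (x⁺) (posPart_nonneg x)
      have hn' := neg_le_abs f (x⁻) (negPart_nonneg x)
      have e1 : f x = f (x⁺) - f (x⁻) := by rw [← map_sub, posPart_sub_negPart]
      have e2 : |f| |x| = |f| (x⁺) + |f| (x⁻) := by rw [← map_add, posPart_add_negPart]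
      simp only [neg_apply] at hp' hn'
      rw [e1, e2, abs_le]
      constructor <;> linarith
    have h2 := h |x| (abs_nonneg x)
    have h3 := bound |x| (abs_nonneg x)
    rw [norm_abs_eq_norm] at h3
    exact h1.trans (h2.trans h3)

end DualLattice

/-- The bidual `E**`. -/
abbrev Bidual (E : Type u) [NormedAddCommGroup E] [NormedSpace ℝ E] : Type u :=
  StrongDual ℝ (StrongDual ℝ E)

/-! ### Regular multilinear operators and Riesz multimorphisms -/

section Multimorphisms

/-- A Riesz homomorphism: a linear operator that preserves finite suprema
(hence also finite infima, since `a ⊓ b = -(-a ⊔ -b)`). -/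
def IsRieszHom {E : Type u} {F : Type v} [AddCommGroup E] [Module ℝ E] [Lattice E]
    [AddCommGroup F] [Module ℝ F] [Lattice F] (T : E →ₗ[ℝ] F) : Prop :=
  ∀ x y : E, T (x ⊔ y) = T x ⊔ T y

variable {m : ℕ} {E : Fin m → Type u} {F : Type v}
  [∀ i, AddCommGroup (E i)] [∀ i, Module ℝ (E i)] [∀ i, Lattice (E i)]
  [AddCommGroup F] [Module ℝ F] [Lattice F]

def IsPositiveMultilinear (A : MultilinearMap ℝ E F) : Prop :=
  ∀ x : ∀ i, E i, (∀ i, 0 ≤ x i) → 0 ≤ A x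

/-- A regular multilinear operator: a difference of two positive ones. -/
def IsRegularMultilinear (A : MultilinearMap ℝ E F) : Prop :=
  ∃ P Q : MultilinearMap ℝ E F,
    IsPositiveMultilinear P ∧ IsPositiveMultilinear Q ∧ A = P - Q

/-- A Riesz multimorphism: a regular multilinear operator with
`|A (x₁, …, xₘ)| = A (|x₁|, …, |xₘ|)`. -/
structure IsRieszMultimorphism (A : MultilinearMap ℝ E F) : Prop where
  regular : IsRegularMultilinear A
  abs_map : ∀ x : ∀ i, E i, |A x| = A fun i => |x i|

end Multimorphisms

/-! ### Automatic continuity of regular multilinear operators on Banach lattices -/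

section Continuity

variable {m : ℕ} {E : Fin m → Type u} {F : Type v}
  [∀ i, NormedAddCommGroup (E i)] [∀ i, NormedSpace ℝ (E i)]
  [∀ i, Lattice (E i)] [∀ i, IsOrderedAddMonoid (E i)] [∀ i, IsOrderedModule ℝ (E i)]
  [∀ i, HasSolidNorm (E i)] [∀ i, CompleteSpace (E i)]
  [NormedAddCommGroup F] [NormedSpace ℝ F] [Lattice F] [IsOrderedAddMonoid F]
  [HasSolidNorm F]


theorem IsPositiveMultilinear.mono {A : MultilinearMap ℝ E F} (hA : IsPositiveMultilinear A)
    {x y : ∀ i, E i} (hx : ∀ i, 0 ≤ x i) (hxy : ∀ i, x i ≤ y i) : A x ≤ A y := by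
  classical
  have e : y = x + (y - x) := by abel
  rw [e, A.map_add_univ]
  have h := Finset.single_le_sum (s := Finset.univ)
    (f := fun s : Finset (Fin m) => A (s.piecewise x (y - x)))
    (fun s _ => hA _ fun i => by
      by_cases hi : i ∈ s
      · simpa [hi] using hx i
      · simpa [hi] using hxy i) (Finset.mem_univ Finset.univ)
  simpa using h

theorem IsPositiveMultilinear.bound_ball {A : MultilinearMap ℝ E F}
    (hA : IsPositiveMultilinear A) :
    ∃ C : ℝ, ∀ x : ∀ i, E i, (∀ i, 0 ≤ x i) → (∀ i, ‖x i‖ ≤ 1) → ‖A x‖ ≤ C := by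
  by_contra! hcon
  choose! x hx0 hx1 hxA using fun n : ℕ => hcon (n * ((2 : ℝ) ^ n) ^ m)
  have hs : ∀ i, Summable fun n : ℕ => ((1 / 2 : ℝ) ^ n) • x n i := fun i => by
    refine Summable.of_norm_bounded (summable_geometric_of_lt_one (r := (1 / 2 : ℝ))
      (by norm_num) (by norm_num)) fun n => ?_
    rw [norm_smul, Real.norm_of_nonneg (by positivity)]
    exact mul_le_of_le_one_right (by positivity) (hx1 n i)
  obtain ⟨n, hn⟩ := exists_nat_gt ‖A fun i => ∑' n : ℕ, ((1 / 2 : ℝ) ^ n) • x n i‖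
  have h0 : ∀ k i, 0 ≤ ((1 / 2 : ℝ) ^ k) • x k i := fun k i =>
    smul_nonneg (by positivity) (hx0 k i)
  have hle : A (fun i => ((1 / 2 : ℝ) ^ n) • x n i) ≤
      A fun i => ∑' n : ℕ, ((1 / 2 : ℝ) ^ n) • x n i :=
    hA.mono (h0 n) fun i => (hs i).le_tsum n fun k _ => h0 k i
  have hnorm : ‖A fun i => ((1 / 2 : ℝ) ^ n) • x n i‖ ≤
      ‖A fun i => ∑' n : ℕ, ((1 / 2 : ℝ) ^ n) • x n i‖ := norm_le_norm_of_abs_le_abs (by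
    rwa [abs_of_nonneg (hA _ (h0 n)), abs_of_nonneg ((hA _ (h0 n)).trans hle)])
  rw [A.map_smul_univ, Finset.prod_const, Finset.card_univ, Fintype.card_fin, norm_smul,
    Real.norm_of_nonneg (by positivity)] at hnorm
  have h2 := mul_lt_mul_of_pos_left (hxA n) (show (0 : ℝ) < ((1 / 2 : ℝ) ^ n) ^ m by positivity)
  have h3 : ((1 / 2 : ℝ) ^ n) ^ m * (n * ((2 : ℝ) ^ n) ^ m) = n := by
    rw [mul_left_comm, ← mul_pow, ← mul_pow]
    norm_num
  linarith

theorem IsPositiveMultilinear.continuous {A : MultilinearMap ℝ E F}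
    (hA : IsPositiveMultilinear A) : Continuous A := by
  classical
  obtain ⟨C, hC⟩ := hA.bound_ball
  have hpos : ∀ x : ∀ i, E i, (∀ i, 0 ≤ x i) → ‖A x‖ ≤ C * ∏ i, ‖x i‖ := by
    intro x hx
    have e : x = fun i => ‖x i‖ • (‖x i‖⁻¹ • x i) := by
      funext i
      by_cases h : x i = 0
      · simp [h]
      · rw [smul_smul, mul_inv_cancel₀ (norm_ne_zero_iff.2 h), one_smul]
    have hp : 0 ≤ ∏ i, ‖x i‖ := Finset.prod_nonneg fun i _ => norm_nonneg _
    have h1 : A x = (∏ i, ‖x i‖) • A fun i => ‖x i‖⁻¹ • x i := by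
      conv_lhs => rw [e]
      exact A.map_smul_univ _ _
    rw [h1, norm_smul, Real.norm_of_nonneg hp, mul_comm]
    refine mul_le_mul_of_nonneg_right (hC _ (fun i => ?_) fun i => ?_) hp
    · exact smul_nonneg (inv_nonneg.2 (norm_nonneg _)) (hx i)
    · rw [norm_smul, norm_inv, norm_norm]
      exact inv_mul_le_one
  have hC0 : 0 ≤ C := (norm_nonneg _).trans (hC 0 (fun _ => le_rfl) fun _ => by simp)
  refine A.continuous_of_bound (∑ _s : Finset (Fin m), C) fun x => ?_
  have e : x = (fun i => (x i)⁺) + fun i => (-1 : ℝ) • (x i)⁻ := by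
    funext i
    simp [← sub_eq_add_neg]
  conv_lhs => rw [e]
  rw [A.map_add_univ, Finset.sum_mul]
  refine (norm_sum_le _ _).trans (Finset.sum_le_sum fun s _ => ?_)
  have e2 : s.piecewise (fun i => (x i)⁺) (fun i => (-1 : ℝ) • (x i)⁻) =
      fun i => (if i ∈ s then (1 : ℝ) else -1) •
        s.piecewise (fun i => (x i)⁺) (fun i => (x i)⁻) i := by
    funext i
    by_cases hi : i ∈ s <;> simp [hi]
  have hone : ‖∏ i : Fin m, (if i ∈ s then (1 : ℝ) else -1)‖ = 1 := by
    rw [norm_prod]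
    exact Finset.prod_eq_one fun i _ => by split_ifs <;> simp
  rw [e2, A.map_smul_univ, norm_smul, hone, one_mul]
  refine (hpos _ fun i => ?_).trans (mul_le_mul_of_nonneg_left
    (Finset.prod_le_prod (fun i _ => norm_nonneg _) fun i _ => ?_) hC0)
  · by_cases hi : i ∈ s
    · simp [hi]
    · simp [hi]
  · by_cases hi : i ∈ s
    · simp only [Finset.piecewise, hi, if_true]
      refine HasSolidNorm.solid ?_
      rw [abs_of_nonneg (posPart_nonneg _)]
      exact sup_le (le_abs_self _) (abs_nonneg _)
    · simp only [Finset.piecewise, hi, if_false]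
      refine HasSolidNorm.solid ?_
      rw [abs_of_nonneg (negPart_nonneg _)]
      exact sup_le (neg_le_abs _) (abs_nonneg _)

theorem IsRegularMultilinear.continuous {A : MultilinearMap ℝ E F}
    (hA : IsRegularMultilinear A) : Continuous A := by
  obtain ⟨P, Q, hP, hQ, rfl⟩ := hA
  exact hP.continuous.sub hQ.continuous

end Continuity

/-! ### Aron-Berner extensions -/

section AronBerner

/-- For `x'' ∈ E₀**`, the operator `B ↦ ((x₁, …, xₘ) ↦ x'' (B (•, x₁, …, xₘ)))`, which sends
`(m+1)`-linear forms on `E₀ × ⋯ × Eₘ` to `m`-linear forms on `E₁ × ⋯ × Eₘ`. -/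
def barOp {m : ℕ} {E : Fin (m + 1) → Type u} [∀ i, NormedAddCommGroup (E i)]
    [∀ i, NormedSpace ℝ (E i)] (x : Bidual (E 0)) :
    ContinuousMultilinearMap ℝ E ℝ →L[ℝ]
      ContinuousMultilinearMap ℝ (fun i : Fin m => E i.succ) ℝ :=
  (ContinuousLinearMap.compContinuousMultilinearMapL ℝ (fun i : Fin m => E i.succ)
      (StrongDual ℝ (E 0)) ℝ x) ∘L
    (ContinuousLinearMap.flipMultilinearEquiv ℝ (fun i : Fin m => E i.succ)
      (E 0) ℝ).toContinuousLinearMap ∘L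
    (continuousMultilinearCurryLeftEquiv ℝ E ℝ).toContinuousLinearEquiv.toContinuousLinearMap

theorem barOp_apply {m : ℕ} {E : Fin (m + 1) → Type u} [∀ i, NormedAddCommGroup (E i)]
    [∀ i, NormedSpace ℝ (E i)] (x : Bidual (E 0)) (B : ContinuousMultilinearMap ℝ E ℝ)
    (t : ∀ i : Fin m, E i.succ) :
    barOp x B t = x (B.curryLeft.flipMultilinear t) := rfl

/-- The composition of the operators `barOp`, where the first variable is removed first:
a continuous multilinear form on `E₀ × ⋯ × Eₘ₋₁` is sent to a scalar. -/
def iterBar : ∀ {m : ℕ} {E : Fin m → Type u} [∀ i, NormedAddCommGroup (E i)]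
    [∀ i, NormedSpace ℝ (E i)], (∀ i, Bidual (E i)) → (ContinuousMultilinearMap ℝ E ℝ →L[ℝ] ℝ)
  | 0, E, _, _, _ => ContinuousMultilinearMap.apply ℝ E ℝ 0
  | _ + 1, _, _, _, x => (iterBar fun i => x i.succ) ∘L barOp (x 0)

theorem iterBar_update_add {m : ℕ} {E : Fin m → Type u} [∀ i, NormedAddCommGroup (E i)]
    [∀ i, NormedSpace ℝ (E i)] (x : ∀ i, Bidual (E i)) (i : Fin m) (a b : Bidual (E i)) :
    iterBar (Function.update x i (a + b)) =
      iterBar (Function.update x i a) + iterBar (Function.update x i b) := by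
  induction m with
  | zero => exact i.elim0
  | succ m ih =>
    cases i using Fin.cases with
    | zero =>
      ext B
      simp [iterBar, barOp]
    | succ j =>
      have h : ∀ c : Bidual (E j.succ), (fun k : Fin m => Function.update x j.succ c k.succ) =
          Function.update (fun k : Fin m => x k.succ) j c := fun c =>
        Function.update_comp_eq_of_injective' x (Fin.succ_injective m) j c
      ext B
      have := ih (fun k : Fin m => x k.succ) j a b
      simp [iterBar, h, this, (Fin.succ_ne_zero j).symm]

theorem iterBar_update_smul {m : ℕ} {E : Fin m → Type u} [∀ i, NormedAddCommGroup (E i)]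
    [∀ i, NormedSpace ℝ (E i)] (x : ∀ i, Bidual (E i)) (i : Fin m) (r : ℝ) (a : Bidual (E i)) :
    iterBar (Function.update x i (r • a)) = r • iterBar (Function.update x i a) := by
  induction m with
  | zero => exact i.elim0
  | succ m ih =>
    cases i using Fin.cases with
    | zero =>
      ext B
      simp [iterBar, barOp]
    | succ j =>
      have h : ∀ c : Bidual (E j.succ), (fun k : Fin m => Function.update x j.succ c k.succ) =
          Function.update (fun k : Fin m => x k.succ) j c := fun c =>
        Function.update_comp_eq_of_injective' x (Fin.succ_injective m) j c
      ext B
      have := ih (fun k : Fin m => x k.succ) j a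
      simp [iterBar, h, this, (Fin.succ_ne_zero j).symm]

/-- Reordering of the variables: `(permuteVars ρ A) z = A x` where `x (ρ k) = z k`. -/
def permuteVars {m : ℕ} {E : Fin m → Type u} {F : Type v} [∀ i, NormedAddCommGroup (E i)]
    [∀ i, NormedSpace ℝ (E i)] [NormedAddCommGroup F] [NormedSpace ℝ F]
    (ρ : Equiv.Perm (Fin m)) (A : ContinuousMultilinearMap ℝ E F) :
    ContinuousMultilinearMap ℝ (fun k => E (ρ k)) F where
  toMultilinearMap := MultilinearMap.domDomCongrLinearEquiv' ℝ ℝ E F ρ.symm A.toMultilinearMap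
  cont := by
    refine A.cont.comp (continuous_pi fun i => ?_)
    obtain ⟨k, rfl⟩ := ρ.surjective i
    refine (continuous_apply k).congr fun z => ?_
    exact (Equiv.piCongrLeft_apply_apply E ρ z k).symm

theorem permuteVars_apply {m : ℕ} {E : Fin m → Type u} {F : Type v}
    [∀ i, NormedAddCommGroup (E i)] [∀ i, NormedSpace ℝ (E i)] [NormedAddCommGroup F]
    [NormedSpace ℝ F] (ρ : Equiv.Perm (Fin m)) (A : ContinuousMultilinearMap ℝ E F)
    (x : ∀ i, E i) : permuteVars ρ A (fun k => x (ρ k)) = A x := by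
  refine congrArg A (funext fun i => ?_)
  obtain ⟨k, rfl⟩ := ρ.surjective i
  exact Equiv.piCongrLeft_apply_apply E ρ (fun k => x (ρ k)) k

variable {m : ℕ} {E : Fin m → Type u} {F : Type v}
  [∀ i, NormedAddCommGroup (E i)] [∀ i, NormedSpace ℝ (E i)]
  [∀ i, Lattice (E i)] [∀ i, IsOrderedAddMonoid (E i)] [∀ i, IsOrderedModule ℝ (E i)]
  [∀ i, HasSolidNorm (E i)] [∀ i, CompleteSpace (E i)]
  [NormedAddCommGroup F] [NormedSpace ℝ F] [Lattice F] [IsOrderedAddMonoid F]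
  [HasSolidNorm F]

/-- The Aron-Berner extension of the regular `m`-linear operator `A` associated with the
permutation `ρ`:  `(x₁'', …, xₘ'')` is sent to the functional on `F*` whose value at `y'` is
obtained from the `m`-linear form `y' ∘ A` by applying `x''_{ρ(1)}` to the variable `ρ(1)`,
then `x''_{ρ(2)}` to the variable `ρ(2)`, and so on. -/
def aronBerner (A : MultilinearMap ℝ E F) (hA : IsRegularMultilinear A)
    (ρ : Equiv.Perm (Fin m)) : MultilinearMap ℝ (fun i => Bidual (E i)) (Bidual F) where
  toFun x := iterBar (fun k => x (ρ k)) ∘L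
    (ContinuousLinearMap.compContinuousMultilinearMapL ℝ (fun k => E (ρ k)) F ℝ).flip
      (permuteVars ρ ⟨A, hA.continuous⟩)
  map_update_add' x i a b := by
    obtain ⟨k, rfl⟩ := ρ.surjective i
    rename_i inst
    obtain rfl : inst = instDecidableEqFin m := Subsingleton.elim _ _
    have h : ∀ c : Bidual (E (ρ k)), (fun j => Function.update x (ρ k) c (ρ j)) =
        Function.update (fun j => x (ρ j)) k c := fun c =>
      Function.update_comp_eq_of_injective' x ρ.injective k c
    rw [h, h, h, iterBar_update_add, ContinuousLinearMap.add_comp]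
  map_update_smul' x i r a := by
    obtain ⟨k, rfl⟩ := ρ.surjective i
    rename_i inst
    obtain rfl : inst = instDecidableEqFin m := Subsingleton.elim _ _
    have h : ∀ c : Bidual (E (ρ k)), (fun j => Function.update x (ρ k) c (ρ j)) =
        Function.update (fun j => x (ρ j)) k c := fun c =>
      Function.update_comp_eq_of_injective' x ρ.injective k c
    rw [h, h, iterBar_update_smul, ContinuousLinearMap.smul_comp]

theorem aronBerner_apply (A : MultilinearMap ℝ E F) (hA : IsRegularMultilinear A)
    (ρ : Equiv.Perm (Fin m)) (x : ∀ i, Bidual (E i)) (y : StrongDual ℝ F) :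
    aronBerner A hA ρ x y = iterBar (fun k => x (ρ k))
      (y.compContinuousMultilinearMap (permuteVars ρ ⟨A, hA.continuous⟩)) := rfl

end AronBerner

end

/-! ### Real-valued Riesz homomorphisms -/

section RealRieszHom

variable {E : Type u} [AddCommGroup E] [Module ℝ E] [Lattice E]

/-! Everything is tested against a Riesz homomorphism `φ` on `F`. The form `φ ∘ A` is then a
real-valued Riesz multimorphism, and such forms are products of Riesz homomorphisms up to a
nonnegative constant: two slices in one variable are dominated by a common slice at a positive
point, which is a Riesz homomorphism, and a functional dominated by a real Riesz homomorphism is a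
multiple of it. Hence the iterated extension sends `x` to `c * ∏ i, x i (ψ i)`; the order of the
variables only relabels the factors.

Evaluation at a Riesz homomorphism commutes with the modulus of the bidual, because the order
interval below such a functional consists of its multiples. Applied to each factor, this gives the
multimorphism identity at `φ`; applied once more in `F**`, it gives (b) at `φ`, and linearity and
continuity in the functional give the closed span.

For (a), a `w*`-continuous functional on `F**` is evaluation at some `φ`. This `φ` is itself a Riesz
homomorphism, since evaluation at `φ` preserves suprema in the bidual and positive parts of points
of `E` are controlled there by a Hahn-Banach argument. -/

theorem IsRieszHom.map_abs {φ : E →ₗ[ℝ] ℝ} (h : IsRieszHom φ) (x : E) : φ |x| = |φ x| := by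
  simpa [abs] using h x (-x)

/-- A functional dominated by a real-valued Riesz homomorphism `ψ` is proportional to `ψ`. -/
theorem IsRieszHom.mul_comm_of_dominated {ψ f : E →ₗ[ℝ] ℝ} (hψ : IsRieszHom ψ)
    (hf : ∀ a, |f a| ≤ ψ |a|) (a b : E) : f a * ψ b = ψ a * f b := by
  -- The test vector lies in the kernel of `ψ`, so `ψ` of its modulus is zero and domination makes
  -- `f` vanish on it.
  have h := hf (ψ b • a - ψ a • b)
  rw [hψ.map_abs] at h
  simp only [map_sub, map_smul, smul_eq_mul] at h
  rw [mul_comm (ψ b) (ψ a), sub_self, abs_zero, abs_nonpos_iff] at h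
  linarith

/-- Two functionals dominated by the same real-valued Riesz homomorphism are proportional. -/
theorem IsRieszHom.mul_comm_of_dominated₂ {ψ f g : E →ₗ[ℝ] ℝ} (hψ : IsRieszHom ψ)
    (hf : ∀ a, |f a| ≤ ψ |a|) (hg : ∀ a, |g a| ≤ ψ |a|) (a b : E) : f a * g b = f b * g a := by
  by_cases hc : ∃ c, ψ c ≠ 0
  · obtain ⟨c, hc⟩ := hc
    have e1 := hψ.mul_comm_of_dominated hf a c
    have e2 := hψ.mul_comm_of_dominated hf b c
    have e3 := hψ.mul_comm_of_dominated hg a c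
    have e4 := hψ.mul_comm_of_dominated hg b c
    refine mul_right_cancel₀ (mul_ne_zero hc hc) ?_
    calc f a * g b * (ψ c * ψ c) = (f a * ψ c) * (g b * ψ c) := by ring
      _ = (f b * ψ c) * (g a * ψ c) := by rw [e1, e2, e3, e4]; ring
      _ = f b * g a * (ψ c * ψ c) := by ring
  · push Not at hc
    have h0 : ∀ x, f x = 0 := fun x => by simpa [hc] using hf x
    simp [h0]

variable [IsOrderedAddMonoid E]

theorem isRieszHom_of_map_abs {φ : E →ₗ[ℝ] ℝ} (h : ∀ x, φ |x| = |φ x|) : IsRieszHom φ := by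
  intro x y
  have h1 := congrArg φ (two_nsmul_sup_eq_add_add_abs_sub x y)
  have h2 := two_nsmul_sup_eq_add_add_abs_sub (φ x) (φ y)
  rw [map_add, map_add, h, map_sub, ← h2, map_nsmul] at h1
  simpa using h1

theorem IsRieszHom.map_nonneg {φ : E →ₗ[ℝ] ℝ} (h : IsRieszHom φ) {x : E} (hx : 0 ≤ x) :
    0 ≤ φ x := by
  rw [← abs_of_nonneg hx, h.map_abs]
  exact abs_nonneg _

end RealRieszHom

/-- A functional on a bidual which is continuous for the weak-star topology is an evaluation. -/
theorem exists_eq_eval_of_weakDual_continuous {X : Type v} [NormedAddCommGroup X]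
    [NormedSpace ℝ X] (y : StrongDual ℝ (StrongDual ℝ X))
    (hy : Continuous fun z : WeakDual ℝ X => y (WeakDual.toStrongDual z)) :
    ∃ x : X, ∀ z : StrongDual ℝ X, y z = z x := by
  let y' : StrongDual ℝ (WeakDual ℝ X) :=
    { toFun := fun z => y (WeakDual.toStrongDual z)
      map_add' := fun a b => by rw [map_add, map_add]
      map_smul' := fun c a => by rw [map_smul, map_smul, RingHom.id_apply]
      cont := hy }
  obtain ⟨x, hx⟩ := LinearMap.dualEmbedding_surjective (topDualPairing ℝ X) y'
  exact ⟨x, fun z => (DFunLike.congr_fun hx (StrongDual.toWeakDual z)).symm⟩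

/-! ### Evaluation of the dual lattice operations -/

section DualEvaluation

variable {E : Type u} [NormedAddCommGroup E] [NormedSpace ℝ E] [Lattice E]
  [IsOrderedAddMonoid E] [HasSolidNorm E]

/-- Comes from `|f| = (2f)⁺ - f`; an upper bound for `|f| a` is thereby reduced to bounding `f` on
the order interval from `0` to `a`. -/
theorem dual_abs_apply (f : StrongDual ℝ E) {a : E} (ha : 0 ≤ a) :
    |f| a = dualPosCone (f - -f) a - f a := by
  change (-f + dualPos (f - -f)) a = _
  rw [add_apply, neg_apply, dualPos_apply _ ha]
  ring

/-- The modulus of the bidual commutes with evaluation at real-valued Riesz homomorphisms. -/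
theorem bidual_abs_apply_of_isRieszHom {φ : StrongDual ℝ E}
    (hφ : IsRieszHom (φ : E →ₗ[ℝ] ℝ)) (f : Bidual E) : |f| φ = |f φ| := by
  have hφ0 : 0 ≤ φ := fun a ha => hφ.map_nonneg ha
  apply le_antisymm
  · rw [dual_abs_apply f hφ0]
    -- Each `g` between `0` and `φ` equals `t • φ` with `0 ≤ t ≤ 1`, so the bound to prove is `2 * t
    -- * f φ ≤ f φ + |f φ|`, that is, `(2 * t - 1) * f φ ≤ |f φ|`.
    have key := dualPosCone_le (f - -f) hφ0 (c := f φ + |f φ|) fun g hg hgφ => by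
      have hdom : ∀ a, |g a| ≤ φ |a| := fun a => by
        have e : g a = g a⁺ - g a⁻ := by rw [← map_sub, posPart_sub_negPart]
        have e' : φ |a| = φ a⁺ + φ a⁻ := by rw [← map_add, posPart_add_negPart]
        have h1 := hg _ (posPart_nonneg a)
        have h2 := hg _ (negPart_nonneg a)
        have h3 := hgφ _ (posPart_nonneg a)
        have h4 := hgφ _ (negPart_nonneg a)
        simp only [zero_apply] at h1 h2
        rw [e, e', abs_le]
        constructor <;> linarith
      have hprop := hφ.mul_comm_of_dominated (f := (g : E →ₗ[ℝ] ℝ)) hdom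
      obtain ⟨t, ht0, ht1, rfl⟩ : ∃ t : ℝ, 0 ≤ t ∧ t ≤ 1 ∧ g = t • φ := by
        by_cases hc : ∃ c, φ c ≠ 0
        · obtain ⟨c, hc⟩ := hc
          have hpos : 0 < φ |c| := (abs_pos.2 hc).trans_eq (hφ.map_abs c).symm
          refine ⟨g |c| / φ |c|, div_nonneg (hg _ (abs_nonneg c)) hpos.le,
            div_le_one_of_le₀ (hgφ _ (abs_nonneg c)) hpos.le, ?_⟩
          ext a
          have := hprop a |c|
          simp only [ContinuousLinearMap.coe_coe] at this
          simp only [smul_apply, smul_eq_mul]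
          field_simp
          linarith
        · push Not at hc
          refine ⟨0, le_rfl, zero_le_one, ?_⟩
          ext a
          simpa [hc] using hdom a
      simp only [sub_apply, neg_apply, map_smul, smul_eq_mul, sub_neg_eq_add]
      have h1 := le_abs_self (f φ)
      have h2 := neg_abs_le (f φ)
      nlinarith
    linarith
  -- This inequality needs only `0 ≤ φ`.
  · have h1 := le_abs_self f φ hφ0
    have h2 := neg_le_abs f φ hφ0
    rw [neg_apply] at h2
    exact abs_le.2 ⟨by linarith, h1⟩

/-- Hahn-Banach yields `g` with `0 ≤ g ≤ φ` and `g a = φ a⁺`. Writing `â` for evaluation at `a`, it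
follows that `φ a⁺ = â g ≤ (â ⊔ 0) g ≤ (â ⊔ 0) φ`. This lets a supremum taken in the bidual control
a positive part in `E`. -/
theorem map_posPart_le_sup_zero_apply [IsOrderedModule ℝ E] {φ : StrongDual ℝ E} (hφ : 0 ≤ φ)
    (a : E) : φ a⁺ ≤ (ContinuousLinearMap.apply ℝ ℝ a ⊔ 0 : Bidual E) φ := by
  have hmono : ∀ {x y : E}, x ≤ y → φ x ≤ φ y := fun {x y} h => by
    have := hφ _ (sub_nonneg.2 h)
    simp only [zero_apply, map_sub] at this
    linarith
  have hsmul : ∀ c : ℝ, 0 < c → ∀ x : E, (c • x)⁺ = c • x⁺ := fun c hc x => by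
    have := (OrderIso.smulRight (β := E) hc).map_sup x 0
    simp only [OrderIso.smulRight_apply, smul_zero] at this
    exact this.symm
  -- The functional `t • a ↦ t * φ a⁺` on the line through `a` is dominated by the sublinear `x ↦ φ
  -- x⁺`; the case `a = 0` is separate because the line must be spanned by a nonzero vector.
  obtain ⟨g, hga, hg⟩ : ∃ g : E →ₗ[ℝ] ℝ, g a = φ a⁺ ∧ ∀ x, g x ≤ φ x⁺ := by
    by_cases ha : a = 0
    · subst ha
      exact ⟨0, by simp, fun x => by simpa using hφ _ (posPart_nonneg x)⟩
    obtain ⟨g, hg1, hg2⟩ := exists_extension_of_le_sublinear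
      (LinearPMap.mkSpanSingleton (K := ℝ) a (φ a⁺) ha) (fun x => φ x⁺)
      (fun c hc x => by rw [hsmul c hc, map_smul, smul_eq_mul])
      (fun x y => by
        rw [← map_add]
        refine hmono (sup_le (add_le_add (le_posPart x) (le_posPart y)) ?_)
        exact add_nonneg (posPart_nonneg _) (posPart_nonneg _))
      (by
        rintro ⟨x, hx⟩
        obtain ⟨t, rfl⟩ := Submodule.mem_span_singleton.1 hx
        refine (LinearPMap.mkSpanSingleton'_apply _ _ _ t hx).trans_le ?_
        change t * φ a⁺ ≤ φ (t • a)⁺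
        rcases le_or_gt t 0 with ht | ht
        · have h1 := hφ _ (posPart_nonneg a)
          have h2 := hφ _ (posPart_nonneg (t • a))
          exact (mul_nonpos_of_nonpos_of_nonneg ht h1).trans h2
        · rw [hsmul t ht, map_smul, smul_eq_mul])
    refine ⟨g, ?_, hg2⟩
    exact (hg1 ⟨a, Submodule.mem_span_singleton_self a⟩).trans
      (LinearPMap.mkSpanSingleton_apply ℝ ℝ ha _)
  have hg0 : ∀ x, 0 ≤ x → 0 ≤ g x := fun x hx => by
    have := hg (-x)
    rw [posPart_of_nonpos (neg_nonpos.2 hx)] at this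
    simpa using this
  have hgφ : ∀ x, 0 ≤ x → g x ≤ φ x := fun x hx => by
    simpa [posPart_of_nonneg hx] using hg x
  have hbound : ∀ x, ‖g x‖ ≤ ‖φ‖ * ‖x‖ := fun x => by
    have h1 : φ x⁺ ≤ ‖φ‖ * ‖x‖ := le_opNorm_of_abs_le φ (by
      rw [abs_of_nonneg (posPart_nonneg x)]
      exact sup_le (le_abs_self x) (abs_nonneg x))
    have h2 : φ x⁻ ≤ ‖φ‖ * ‖x‖ := le_opNorm_of_abs_le φ (by
      rw [abs_of_nonneg (negPart_nonneg x)]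
      exact sup_le (neg_le_abs x) (abs_nonneg x))
    have h3 := hg x
    have h4 := hg (-x)
    rw [posPart_neg, map_neg] at h4
    rw [Real.norm_eq_abs, abs_le]
    constructor <;> linarith
  let g' : StrongDual ℝ E := g.mkContinuous ‖φ‖ hbound
  have hle : (ContinuousLinearMap.apply ℝ ℝ a : Bidual E) g' ≤
      (ContinuousLinearMap.apply ℝ ℝ a ⊔ 0 : Bidual E) g' :=
    (le_sup_left : (ContinuousLinearMap.apply ℝ ℝ a : Bidual E) ≤ _) g' hg0
  have hle' : 0 ≤ (ContinuousLinearMap.apply ℝ ℝ a ⊔ 0 : Bidual E) (φ - g') :=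
    (le_sup_right : (0 : Bidual E) ≤ ContinuousLinearMap.apply ℝ ℝ a ⊔ 0) (φ - g')
      fun x hx => by simpa [g'] using hgφ x hx
  rw [map_sub] at hle'
  have : (ContinuousLinearMap.apply ℝ ℝ a : Bidual E) g' = φ a⁺ := hga
  linarith

/-- If evaluation at `φ` is a Riesz homomorphism on the bidual, then so is `φ`. -/
theorem isRieszHom_of_isRieszHom_eval [IsOrderedModule ℝ E] {φ : StrongDual ℝ E}
    (h : ∀ x y : Bidual E, (x ⊔ y) φ = x φ ⊔ y φ) : IsRieszHom (φ : E →ₗ[ℝ] ℝ) := by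
  -- Evaluation at a positive `a` is positive in the bidual, so its supremum with `0` changes
  -- nothing and the hypothesis reads `φ a = φ a ⊔ 0`.
  have hφ : 0 ≤ φ := fun a ha => by
    have h0 : (0 : Bidual E) ≤ ContinuousLinearMap.apply ℝ ℝ a := fun g hg => hg a ha
    have := h (ContinuousLinearMap.apply ℝ ℝ a) 0
    rw [sup_eq_left.2 h0] at this
    exact sup_eq_left.1 this.symm
  have hpos : ∀ a, φ a⁺ = φ a ⊔ 0 := fun a => by
    apply le_antisymm
    · exact (map_posPart_le_sup_zero_apply hφ a).trans_eq (h _ _)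
    · refine sup_le ?_ (hφ _ (posPart_nonneg a))
      have := hφ _ (sub_nonneg.2 (le_posPart a))
      simpa using this
  intro x y
  have e : x ⊔ y = (x - y)⁺ + y := by
    rw [posPart_def, sup_add]; simp
  simp only [ContinuousLinearMap.coe_coe]
  rw [e, map_add, hpos, map_sub, sup_add]
  simp

end DualEvaluation

/-! ### Real-valued Riesz multimorphisms and their Aron-Berner extensions -/

section RealMultimorphism

theorem isPositiveMultilinear_of_abs_map {m : ℕ} {E : Fin m → Type u}
    [∀ i, AddCommGroup (E i)] [∀ i, Module ℝ (E i)]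
    [∀ i, Lattice (E i)] [∀ i, IsOrderedAddMonoid (E i)] {B : MultilinearMap ℝ E ℝ}
    (hB : ∀ x, |B x| = B fun i => |x i|) : IsPositiveMultilinear B := fun x hx => by
  have e : (fun i => |x i|) = x := funext fun i => abs_of_nonneg (hx i)
  have := hB x
  rw [e] at this
  exact abs_eq_self.1 this

/-- The slices in the first variable of a real-valued Riesz multimorphism are proportional. -/
theorem mul_cons_comm_of_abs_map {m : ℕ} {E : Fin (m + 1) → Type u}
    [∀ i, NormedAddCommGroup (E i)] [∀ i, NormedSpace ℝ (E i)]
    [∀ i, Lattice (E i)] [∀ i, IsOrderedAddMonoid (E i)] [∀ i, IsOrderedModule ℝ (E i)]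
    [∀ i, HasSolidNorm (E i)] [∀ i, CompleteSpace (E i)]
    {B : ContinuousMultilinearMap ℝ E ℝ} (hB : ∀ x, |B x| = B fun i => |x i|)
    (a b : E 0) (t s : ∀ i : Fin m, E i.succ) :
    B (Fin.cons a t) * B (Fin.cons b s) = B (Fin.cons b t) * B (Fin.cons a s) := by
  have hpos : IsPositiveMultilinear B.toMultilinearMap := isPositiveMultilinear_of_abs_map hB
  have habs : ∀ (c : E 0) (r : ∀ i : Fin m, E i.succ),
      |B (Fin.cons c r)| = B (Fin.cons |c| fun i => |r i|) := fun c r => by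
    rw [hB]
    congr 1
    funext i
    cases i using Fin.cases <;> simp
  let slice (r : ∀ i : Fin m, E i.succ) : E 0 →ₗ[ℝ] ℝ := B.curryLeft.flipMultilinear r
  have hslice : ∀ r c, slice r c = B (Fin.cons c r) := fun _ _ => rfl
  -- The point `p` is positive and dominates both `|t|` and `|s|`: positivity makes its slice a
  -- Riesz homomorphism, and domination puts the slices at `t` and `s` below it.
  let p : ∀ i : Fin m, E i.succ := fun i => |t i| + |s i|
  have hp : ∀ i, 0 ≤ p i := fun i => add_nonneg (abs_nonneg _) (abs_nonneg _)
  have hψ : IsRieszHom (slice p) := isRieszHom_of_map_abs fun c => by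
    rw [hslice, hslice, habs]
    simp only [abs_of_nonneg (hp _)]
  have hdom : ∀ r : ∀ i : Fin m, E i.succ, (∀ i, |r i| ≤ p i) → ∀ c, |slice r c| ≤ slice p |c| := by
    intro r hr c
    rw [hslice, hslice, habs]
    refine hpos.mono (fun i => ?_) fun i => ?_
    · cases i using Fin.cases <;> simp
    · cases i using Fin.cases with
      | zero => simp
      | succ j => simpa using hr j
  exact hψ.mul_comm_of_dominated₂ (hdom t fun i => le_add_of_nonneg_right (abs_nonneg _))
    (hdom s fun i => le_add_of_nonneg_left (abs_nonneg _)) a b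

/-- The iterated evaluation of a real-valued Riesz multimorphism is a product of evaluations at
Riesz homomorphisms. -/
theorem exists_iterBar_eq_mul_prod {m : ℕ} {E : Fin m → Type u}
    [∀ i, NormedAddCommGroup (E i)] [∀ i, NormedSpace ℝ (E i)]
    [∀ i, Lattice (E i)] [∀ i, IsOrderedAddMonoid (E i)] [∀ i, IsOrderedModule ℝ (E i)]
    [∀ i, HasSolidNorm (E i)] [∀ i, CompleteSpace (E i)]
    (B : ContinuousMultilinearMap ℝ E ℝ) (hB : ∀ x, |B x| = B fun i => |x i|) :
    ∃ (c : ℝ) (φ : ∀ i, StrongDual ℝ (E i)), 0 ≤ c ∧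
      (∀ i, IsRieszHom (φ i : E i →ₗ[ℝ] ℝ)) ∧
      ∀ x : ∀ i, Bidual (E i), iterBar x B = c * ∏ i, x i (φ i) := by
  induction m with
  | zero =>
    refine ⟨B 0, fun i => i.elim0, ?_, fun i => i.elim0, fun x => by simp [iterBar]⟩
    exact isPositiveMultilinear_of_abs_map (B := B.toMultilinearMap) hB _ fun i => i.elim0
  | succ m ih =>
    by_cases h0 : B = 0
    · subst h0
      exact ⟨0, 0, le_rfl, fun i => isRieszHom_of_map_abs fun x => by simp, fun x => by simp⟩
    obtain ⟨u, hu⟩ : ∃ u, B u ≠ 0 := by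
      by_contra! h
      exact h0 (ContinuousMultilinearMap.ext h)
    -- A positive base point with `B v = |B u| > 0`, used to normalize. Freezing its first
    -- coordinate keeps `B` a Riesz multimorphism in the remaining variables, so the induction
    -- hypothesis applies.
    let v : ∀ i, E i := fun i => |u i|
    have hv0 : ∀ i, |v i| = v i := fun i => abs_abs _
    have hv : 0 < B v := (abs_pos.2 hu).trans_eq (hB u)
    have hcons : ∀ (a : E 0) (t : ∀ i : Fin m, E i.succ),
        (fun i => |(Fin.cons a t : ∀ i, E i) i|) = Fin.cons |a| fun i => |t i| := fun a t => by
      funext i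
      cases i using Fin.cases <;> simp
    obtain ⟨c, φ, hc, hφ, hx⟩ := ih (B.curryLeft (v 0)) fun t => by
      simp only [ContinuousMultilinearMap.curryLeft_apply]
      rw [hB, hcons, hv0]
    let φ₀ : StrongDual ℝ (E 0) := B.curryLeft.flipMultilinear fun i => v i.succ
    have hφ₀ : ∀ a, φ₀ a = B (Fin.cons a fun i => v i.succ) := fun _ => rfl
    -- Proportionality of slices gives `B (a, t) = φ₀ a * B (v 0, t) / B v`, so `φ₀` is the first
    -- factor and the constant acquires the denominator `B v`.
    refine ⟨c / B v, Fin.cons φ₀ φ, div_nonneg hc hv.le, fun i => ?_, fun x => ?_⟩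
    · cases i using Fin.cases with
      | zero =>
        refine isRieszHom_of_map_abs fun a => ?_
        simp only [Fin.cons_zero, ContinuousLinearMap.coe_coe, hφ₀]
        rw [hB, hcons]
        simp only [hv0]
      | succ j => exact hφ j
    · have hbar : barOp (x 0) B = (x 0 φ₀ / B v) • B.curryLeft (v 0) := by
        ext t
        have e : B.curryLeft.flipMultilinear t = (B (Fin.cons (v 0) t) / B v) • φ₀ := by
          ext a
          have h := mul_cons_comm_of_abs_map hB a (v 0) t fun i => v i.succ
          have hvv : (Fin.cons (v 0) fun i : Fin m => v i.succ : ∀ i, E i) = v :=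
            Fin.cons_self_tail v
          rw [hvv] at h
          change B (Fin.cons a t) = B (Fin.cons (v 0) t) / B v * φ₀ a
          rw [hφ₀]
          field_simp
          exact h
        rw [barOp_apply, e, map_smul, smul_apply, ContinuousMultilinearMap.curryLeft_apply]
        simp only [smul_eq_mul]
        ring
      change iterBar (fun i => x i.succ) (barOp (x 0) B) = _
      rw [hbar, map_smul, hx, Fin.prod_univ_succ]
      simp only [Fin.cons_zero, Fin.cons_succ, smul_eq_mul]
      ring

end RealMultimorphism
-- Aron-Berner extensions of Riesz multimorphisms
theorem proposition3p5 {m : ℕ} {E : Fin m → Type u} {F : Type v}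
    [∀ i, NormedAddCommGroup (E i)] [∀ i, NormedSpace ℝ (E i)]
    [∀ i, Lattice (E i)] [∀ i, IsOrderedAddMonoid (E i)] [∀ i, IsOrderedModule ℝ (E i)]
    [∀ i, HasSolidNorm (E i)] [∀ i, CompleteSpace (E i)]
    [NormedAddCommGroup F] [NormedSpace ℝ F] [Lattice F] [IsOrderedAddMonoid F]
    [IsOrderedModule ℝ F] [HasSolidNorm F] [CompleteSpace F]
    (A : MultilinearMap ℝ E F) (hA : IsRieszMultimorphism A) (ρ : Equiv.Perm (Fin m)) :
    (∀ y : StrongDual ℝ (Bidual F),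
      Continuous (fun z : WeakDual ℝ (StrongDual ℝ F) => y (WeakDual.toStrongDual z)) →
      IsRieszHom (E := Bidual F) (F := ℝ) (y : Bidual F →ₗ[ℝ] ℝ) →
      IsRieszMultimorphism (E := fun i => Bidual (E i)) (F := ℝ)
        ((y : Bidual F →ₗ[ℝ] ℝ).compMultilinearMap (aronBerner A hA.regular ρ))) ∧
    (∀ (x : ∀ i, Bidual (E i)) (y : StrongDual ℝ F),
      y ∈ (Submodule.span ℝ
        {φ : StrongDual ℝ F | IsRieszHom (E := F) (F := ℝ) (φ : F →ₗ[ℝ] ℝ)}).topologicalClosure →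
      |aronBerner A hA.regular ρ x| y = aronBerner A hA.regular ρ (fun i => |x i|) y) := by
  -- Both properties are read off the product formula for the form `φ ∘ A`; positivity is kept
  -- alongside the modulus identity because it supplies regularity in (a).
  have key : ∀ φ : StrongDual ℝ F, IsRieszHom (φ : F →ₗ[ℝ] ℝ) →
      (∀ x, |aronBerner A hA.regular ρ x φ| = aronBerner A hA.regular ρ (fun i => |x i|) φ) ∧
      ∀ x : ∀ i, Bidual (E i), (∀ i, 0 ≤ x i) → 0 ≤ aronBerner A hA.regular ρ x φ := by
    intro φ hφ
    have hB : ∀ z, |φ.compContinuousMultilinearMap (permuteVars ρ ⟨A, hA.regular.continuous⟩) z| =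
        φ.compContinuousMultilinearMap (permuteVars ρ ⟨A, hA.regular.continuous⟩)
          fun k => |z k| := by
      intro z
      obtain ⟨x, rfl⟩ : ∃ x : ∀ i, E i, (fun k => x (ρ k)) = z :=
        ⟨Equiv.piCongrLeft E ρ z, funext fun k => Equiv.piCongrLeft_apply_apply E ρ z k⟩
      simp only [ContinuousLinearMap.compContinuousMultilinearMap_coe, Function.comp_apply]
      rw [permuteVars_apply, permuteVars_apply ρ _ fun i => |x i|]
      change |φ (A x)| = φ (A fun i => |x i|)
      rw [← hA.abs_map]
      exact (hφ.map_abs _).symm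
    obtain ⟨c, ψ, hc, hψ, h⟩ := exists_iterBar_eq_mul_prod _ hB
    simp only [aronBerner_apply, h]
    refine ⟨fun x => ?_, fun x hx => ?_⟩
    · rw [abs_mul, abs_of_nonneg hc, Finset.abs_prod]
      simp only [bidual_abs_apply_of_isRieszHom (hψ _)]
    · exact mul_nonneg hc (Finset.prod_nonneg fun k _ => hx _ _ fun a ha => (hψ k).map_nonneg ha)
  refine ⟨fun y hy hyR => ?_, fun x y hy => ?_⟩
  · obtain ⟨φ, hφ⟩ := exists_eq_eval_of_weakDual_continuous y hy
    have hφR : IsRieszHom (φ : F →ₗ[ℝ] ℝ) := isRieszHom_of_isRieszHom_eval fun a b => by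
      simpa [hφ] using hyR a b
    obtain ⟨h1, h2⟩ := key φ hφR
    -- A positive form is regular, being itself minus zero.
    refine ⟨⟨_, 0, ?_, fun _ _ => le_rfl, (sub_zero _).symm⟩, fun x => ?_⟩
    · intro x hx
      simpa [hφ] using h2 x hx
    · simpa [hφ] using h1 x
  -- Both sides are continuous and linear in `y`, so they agree on a closed subspace, the kernel of
  -- their difference; it suffices that it contains the Riesz homomorphisms.
  · have hle : (Submodule.span ℝ
        {φ : StrongDual ℝ F | IsRieszHom (E := F) (F := ℝ) (φ : F →ₗ[ℝ] ℝ)}).topologicalClosure ≤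
        LinearMap.ker ((|aronBerner A hA.regular ρ x| -
          aronBerner A hA.regular ρ fun i => |x i| : Bidual F) : StrongDual ℝ F →ₗ[ℝ] ℝ) := by
      refine Submodule.topologicalClosure_minimal _ (Submodule.span_le.2 fun φ hφ => ?_)
        (ContinuousLinearMap.isClosed_ker _)
      have := (key φ hφ).1 x
      rw [← bidual_abs_apply_of_isRieszHom hφ] at this
      simpa [sub_eq_zero] using this
    simpa [sub_eq_zero] using hle hy
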